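/- Let $(\mathcal X,d)$ be a finite metric space with $N=|\mathcal X|$ points, let $p\ge 1$ be a real number, and let $r=(r_x)_{x\in\mathcal X}$ and $s=(s_x)_{x\in\mathcal X}$ be probability vectors on $\mathcal X$. Let $$W_p(r,s)=\Bigl(\min_{w}\sum_{x,x'\in\mathcal X} d(x,x')^p\,w_{x,x'}\Bigr)^{1/p},$$ where the minimum is over all $w\in\mathbb R_{\ge0}^{\mathcal X\times\mathcal X}$ with $\sum_{x'}w_{x,x'}=r_x$ and $\sum_{x}w_{x,x'}=s_{x'}$ for all $x,x'\in\mathcal X$, be the $p$-th Wasserstein distance. For integers $B,S\ge 1$ let $X_{ik}\sim r$ and $Y_{ik}\sim s$ ($1\le i\le B$, $1\le k\le S$) be independent random points of $\mathcal X$ (all $2BS$ of them jointly independent), let $\hat r_{S,i}$ and $\hat s_{S,i}$ be the empirical measures $\hat r_{S,i}(x)=\frac1S\#\{k: X_{ik}=x\}$ and $\hat s_{S,i}(x)=\frac1S\#\{k: Y_{ik}=x\}$, and let $$\hat W^{(S)}_p(r,s)=\frac1B\sum_{i=1}^B W_p(\hat r_{S,i},\hat s_{S,i}).$$ For integers $q\ge2$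 and $l_{\max}\ge 0$ let $$\mathcal E_q=2^{p-1}q^{2p}\,\mathrm{diam}(\mathcal X)^p\Bigl(q^{-(l_{\max}+1)p}\sqrt N+\sum_{l=0}^{l_{\max}}q^{-lp}\sqrt{\mathcal N(\mathcal X,q^{-l}\mathrm{diam}(\mathcal X))}\Bigr),$$ where $\mathcal N(\mathcal X,\delta)$ is the minimal number of closed balls of radius $\delta$ with centers in $\mathcal X$ that cover $\mathcal X$. Then, for all integers $B,S\ge1$, $q\ge2$ and $l_{\max}\ge0$, the squared error is integrable and $$E\Bigl[\bigl|\hat W^{(S)}_p(r,s)-W_p(r,s)\bigr|^2\Bigr]\le 18\,\mathcal E_q^{2/p}\,S^{-1/p}.$$ In particular, the mean squared error is $\mathcal O(S^{-1/p})$ as $S\to\infty$, for any choice of the numbers of repetitions $B=B_S\ge1$. -/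

import Mathlib

open MeasureTheory ProbabilityTheory Filter Asymptotics

namespace EmpiricalOT

/-- The couplings `Π(r, s)` of two vectors on `𝒳`: nonnegative weights with marginals `r`, `s`. -/
def couplings {𝒳 : Type*} [Fintype 𝒳] (r s : 𝒳 → ℝ) : Set (𝒳 → 𝒳 → ℝ) :=
  {w | (∀ x x', 0 ≤ w x x') ∧ (∀ x, ∑ x', w x x' = r x) ∧ ∀ x', ∑ x, w x x' = s x'}

/-- The transport cost `∑ d(x, x')ᵖ w(x, x')` of a transport plan. -/
noncomputable def transportCost {𝒳 : Type*} [Fintype 𝒳] [MetricSpace 𝒳] (p : ℝ)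
    (w : 𝒳 → 𝒳 → ℝ) : ℝ :=
  ∑ x, ∑ x', dist x x' ^ p * w x x'

/-- The minimal transport cost `min_{w ∈ Π(r, s)} ∑ d(x, x')ᵖ w(x, x')`. For probability vectors
the infimum is attained, see `isLeast_minTransportCost`. -/
noncomputable def minTransportCost {𝒳 : Type*} [Fintype 𝒳] [MetricSpace 𝒳] (p : ℝ)
    (r s : 𝒳 → ℝ) : ℝ :=
  sInf (transportCost p '' couplings r s)

theorem isLeast_minTransportCost {𝒳 : Type*} [Fintype 𝒳] [MetricSpace 𝒳] (p : ℝ)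
    {r s : 𝒳 → ℝ} (hr : r ∈ stdSimplex ℝ 𝒳) (hs : s ∈ stdSimplex ℝ 𝒳) :
    IsLeast (transportCost p '' couplings r s) (minTransportCost p r s) := by
  have hne : (couplings r s).Nonempty := by
    refine ⟨fun x x' => r x * s x', fun x x' => mul_nonneg (hr.1 x) (hs.1 x'), fun x => ?_,
      fun x' => ?_⟩
    · rw [← Finset.mul_sum, hs.2, mul_one]
    · rw [← Finset.sum_mul, hr.2, one_mul]
  have hclosed : IsClosed (couplings r s) := by
    have h1 : IsClosed {w : 𝒳 → 𝒳 → ℝ | ∀ x x', 0 ≤ w x x'} := by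
      simp only [Set.ofPred_forall]
      exact isClosed_iInter fun x => isClosed_iInter fun x' =>
        isClosed_le continuous_const (by fun_prop)
    have h2 : IsClosed {w : 𝒳 → 𝒳 → ℝ | ∀ x, ∑ x', w x x' = r x} := by
      simp only [Set.ofPred_forall]
      exact isClosed_iInter fun x => isClosed_eq (by fun_prop) continuous_const
    have h3 : IsClosed {w : 𝒳 → 𝒳 → ℝ | ∀ x', ∑ x, w x x' = s x'} := by
      simp only [Set.ofPred_forall]
      exact isClosed_iInter fun x => isClosed_eq (by fun_prop) continuous_const
    exact h1.inter (h2.inter h3)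
  have hbox : IsCompact (Set.univ.pi fun x : 𝒳 => Set.univ.pi fun _ : 𝒳 => Set.Icc 0 (r x)) :=
    isCompact_univ_pi fun x => isCompact_univ_pi fun _ => isCompact_Icc
  have hcompact : IsCompact (couplings r s) := by
    refine hbox.of_isClosed_subset hclosed fun w hw => ?_
    simp only [Set.mem_pi, Set.mem_univ, true_implies, Set.mem_Icc]
    refine fun x x' => ⟨hw.1 x x', ?_⟩
    rw [← hw.2.1 x]
    exact Finset.single_le_sum (f := fun y => w x y) (fun y _ => hw.1 x y) (Finset.mem_univ x')
  have hcont : Continuous (transportCost p : (𝒳 → 𝒳 → ℝ) → ℝ) := by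
    unfold transportCost
    fun_prop
  exact (hcompact.image hcont).isLeast_sInf (hne.image _)

/-- The `p`-th Wasserstein distance `W_p(r, s)`. -/
noncomputable def wasserstein {𝒳 : Type*} [Fintype 𝒳] [MetricSpace 𝒳] (p : ℝ)
    (r s : 𝒳 → ℝ) : ℝ :=
  minTransportCost p r s ^ (1 / p)

open Classical in
/-- The empirical measure of a sample of size `S`: the relative frequency of every point. -/
noncomputable def empirical {𝒳 : Type*} {S : ℕ} (x : Fin S → 𝒳) : 𝒳 → ℝ :=
  fun a => ((Finset.univ.filter fun k => x k = a).card : ℝ) / S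

/-- The value returned by the subsampling scheme with `B` repetitions and subsample size `S`, when
the points drawn in repetition `i` are `x i` (from the first measure) and `y i` (from the second
one): the average of the `B` empirical optimal transport distances. -/
noncomputable def estimator {𝒳 : Type*} [Fintype 𝒳] [MetricSpace 𝒳] (p : ℝ) {B S : ℕ}
    (x y : Fin B → Fin S → 𝒳) : ℝ :=
  (B : ℝ)⁻¹ * ∑ i, wasserstein p (empirical (x i)) (empirical (y i))

/-- `X` and `Y` are the random draws of the subsampling scheme: the points `X i k` have law `r`,
the points `Y i k` have law `s`, and all these `2 * B * S` random points are independent. -/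
structure IsSample {𝒳 Ω : Type*} [MeasurableSpace 𝒳] [MeasurableSpace Ω] (μ : Measure Ω)
    (r s : 𝒳 → ℝ) {B S : ℕ} (X Y : Fin B → Fin S → Ω → 𝒳) : Prop where
  measurable_left : ∀ i k, Measurable (X i k)
  measurable_right : ∀ i k, Measurable (Y i k)
  law_left : ∀ i k a, μ.real (X i k ⁻¹' {a}) = r a
  law_right : ∀ i k a, μ.real (Y i k ⁻¹' {a}) = s a
  indep : iIndepFun (Sum.elim (fun j : Fin B × Fin S => X j.1 j.2)
    (fun j : Fin B × Fin S => Y j.1 j.2)) μ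

/-- The diameter of the whole space. -/
noncomputable def diam (𝒳 : Type*) [MetricSpace 𝒳] : ℝ :=
  Metric.diam (Set.univ : Set 𝒳)

/-- The covering number `𝒩(𝒳, δ)`: the minimal number of closed balls of radius `δ` with centers
in `𝒳` that cover `𝒳` (finite, as `𝒳` is finite). -/
noncomputable def coveringNumber (𝒳 : Type*) [MetricSpace 𝒳] (δ : ℝ) : ℕ :=
  (Metric.coveringNumber δ.toNNReal (Set.univ : Set 𝒳)).toNat

/-- The constant `ℰ_q(𝒳, p)`, with truncation level `l_max = L`. -/
noncomputable def errorConst (𝒳 : Type*) [Fintype 𝒳] [MetricSpace 𝒳] (p : ℝ) (q L : ℕ) : ℝ :=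
  2 ^ (p - 1) * (q : ℝ) ^ (2 * p) * diam 𝒳 ^ p *
    ((q : ℝ) ^ (-((L + 1 : ℝ) * p)) * √(Fintype.card 𝒳 : ℝ) +
      ∑ l ∈ Finset.range (L + 1),
        (q : ℝ) ^ (-((l : ℝ) * p)) * √(coveringNumber 𝒳 ((q : ℝ) ^ (-(l : ℝ)) * diam 𝒳) : ℝ))

end EmpiricalOT

/-!
Why the bound holds. By the triangle inequality for `W_p`, the error of one repetition is at most
`W_p(r̂, r) + W_p(ŝ, s)`, so it suffices to bound the second moment of the distance between a
measure and its empirical measure; averaging the repetitions does not increase the mean squared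
error. By Jensen's inequality it is even enough to show `E[T²] ≤ ℰ_q² / S` for the transport cost
`T = W_p(r̂, r) ^ p`.

The cost is bounded along a hierarchy of nets of `𝒳` whose radii grow by the factor `q`: every point
has an ancestor in each net, and this gives a chain of coarser and coarser partitions of `𝒳`.
Matching mass inside the finest classes first produces one coupling which, for every level
simultaneously, moves between different classes no more than the total variation distance of the
coarsened measures (`exists_coupling_chain`). Points that are first separated at some level are
close to each other on the scale of this level, hence `T ≤ ∑ A k * classDist (g k) r̂ r` with
explicit weights `A k` (`exists_minTransportCost_le_sum`). Here `classDist (g k) r̂ r` is an `ℓ¹`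
distance on a set of covering-number size `n k`, and its second moment is at most `n k / S`, since
each fibre contributes the variance of an empirical frequency
(`integral_classDist_empirical_sq_le`). The triangle inequality in `L²`, in the form of a weighted
Cauchy-Schwarz inequality, gives `E[T²] ≤ (∑ A k √(n k))² / S ≤ ℰ_q² / S`. This argument yields
the constant `4` in place of `18`.
-/

namespace EmpiricalOT

/-! ### Couplings adapted to a chain of partitions -/

open Classical in
/-- The mass which the vector `r` gives to the fibre `f ⁻¹' {c}`. -/
noncomputable def classMass {𝒳 : Type*} [Fintype 𝒳] (f : 𝒳 → 𝒳) (r : 𝒳 → ℝ) (c : 𝒳) : ℝ :=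
  ∑ x, if f x = c then r x else 0

/-- The `ℓ¹` distance of the images of `r` and `s` under `f`, that is, of their restrictions to
the partition into fibres of `f`. -/
noncomputable def classDist {𝒳 : Type*} [Fintype 𝒳] (f : 𝒳 → 𝒳) (r s : 𝒳 → ℝ) : ℝ :=
  ∑ c, |classMass f r c - classMass f s c|

section Chain

variable {𝒳 : Type*} [Fintype 𝒳]

theorem classMass_nonneg (f : 𝒳 → 𝒳) {r : 𝒳 → ℝ} (hr : ∀ x, 0 ≤ r x) (c : 𝒳) :
    0 ≤ classMass f r c :=
  Finset.sum_nonneg fun x _ => by split_ifs <;> simp [hr x]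

theorem sum_classMass (f : 𝒳 → 𝒳) (r : 𝒳 → ℝ) : ∑ c, classMass f r c = ∑ x, r x := by
  classical
  unfold classMass
  rw [Finset.sum_comm]
  simp

theorem sum_mul_classMass (f : 𝒳 → 𝒳) (r u : 𝒳 → ℝ) :
    ∑ x, r x * u (f x) = ∑ c, classMass f r c * u c := by
  classical
  unfold classMass
  simp only [Finset.sum_mul, ite_mul, zero_mul]
  rw [Finset.sum_comm]
  simp

theorem classMass_sub (f : 𝒳 → 𝒳) (r s : 𝒳 → ℝ) (c : 𝒳) :
    classMass f (fun x => r x - s x) c = classMass f r c - classMass f s c := by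
  unfold classMass
  rw [← Finset.sum_sub_distrib]
  exact Finset.sum_congr rfl fun x _ => by split_ifs <;> simp

theorem sum_posPart_classMass (f : 𝒳 → 𝒳) {r s : 𝒳 → ℝ} (h : ∑ x, r x = ∑ x, s x) :
    ∑ c, max (classMass f r c - classMass f s c) 0 = classDist f r s / 2 := by
  have h0 : ∑ c, (classMass f r c - classMass f s c) = 0 := by
    rw [Finset.sum_sub_distrib, sum_classMass, sum_classMass, h, sub_self]
  have h1 : ∀ t : ℝ, max t 0 = (t + |t|) / 2 := fun t => by
    rcases le_total 0 t with ht | ht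
    · rw [max_eq_left ht, abs_of_nonneg ht]; ring
    · rw [max_eq_right ht, abs_of_nonpos ht]; ring
  simp only [h1]
  rw [← Finset.sum_div, Finset.sum_add_distrib, h0, zero_add, classDist]

/-- Matching as much mass as possible inside each fibre of `f`: the partial transport plan
spreads the common part `min (r C) (s C)` of the masses of a fibre `C` proportionally to `r` and
`s`, so that only the positive part of `r C - s C` is left over. -/
theorem exists_matching (f : 𝒳 → 𝒳) {r s : 𝒳 → ℝ} (hr : ∀ x, 0 ≤ r x) (hs : ∀ x, 0 ≤ s x) :
    ∃ w : 𝒳 → 𝒳 → ℝ, (∀ x y, 0 ≤ w x y) ∧ (∀ x y, f x ≠ f y → w x y = 0) ∧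
      (∀ x, ∑ y, w x y ≤ r x) ∧ (∀ y, ∑ x, w x y ≤ s y) ∧
      ∑ x, (r x - ∑ y, w x y) ≤ ∑ c, max (classMass f r c - classMass f s c) 0 := by
  classical
  set M : 𝒳 → ℝ := fun c => max (classMass f r c) (classMass f s c) with hM
  have hM0 : ∀ c, 0 ≤ M c := fun c => le_max_of_le_left (classMass_nonneg f hr c)
  have hrow : ∀ x, ∑ y, (if f y = f x then r x * s y / M (f x) else 0)
      = r x * (classMass f s (f x) / M (f x)) := fun x => by
    rw [classMass, Finset.sum_div, Finset.mul_sum]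
    exact Finset.sum_congr rfl fun y _ => by split_ifs <;> ring
  have hcol : ∀ y, ∑ x, (if f y = f x then r x * s y / M (f x) else 0)
      = s y * (classMass f r (f y) / M (f y)) := fun y => by
    rw [classMass, Finset.sum_div, Finset.mul_sum]
    refine Finset.sum_congr rfl fun x _ => ?_
    by_cases h : f x = f y
    · simp only [h, if_true]; ring
    · simp [h, Ne.symm h]
  refine ⟨fun x y => if f y = f x then r x * s y / M (f x) else 0, fun x y => ?_, fun x y h => ?_,
    fun x => ?_, fun y => ?_, ?_⟩
  · dsimp only
    split_ifs
    · exact div_nonneg (mul_nonneg (hr x) (hs y)) (hM0 _)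
    · exact le_rfl
  · simp [Ne.symm h]
  · rw [hrow]
    exact mul_le_of_le_one_right (hr x) (div_le_one_of_le₀ (le_max_right _ _) (hM0 _))
  · rw [hcol]
    exact mul_le_of_le_one_right (hs y) (div_le_one_of_le₀ (le_max_left _ _) (hM0 _))
  · simp only [hrow]
    rw [Finset.sum_sub_distrib, sum_mul_classMass f r fun c => classMass f s c / M c,
      ← sum_classMass f r, ← Finset.sum_sub_distrib]
    refine Finset.sum_le_sum fun c _ => ?_
    have hR := classMass_nonneg f hr c
    have hS := classMass_nonneg f hs c
    rcases le_total (classMass f r c) (classMass f s c) with h | h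
    · have hMc : M c = classMass f s c := max_eq_right h
      rw [hMc]
      rcases hS.eq_or_lt with h0 | h0
      · rw [← h0] at h ⊢
        simp [le_antisymm h hR]
      · rw [div_self h0.ne']
        simp
    · have hMc : M c = classMass f r c := max_eq_left h
      rw [hMc]
      rcases hR.eq_or_lt with h0 | h0
      · rw [← h0] at h ⊢
        simp
      · rw [mul_div_cancel₀ _ h0.ne']
        exact le_max_left _ _

/-- The product plan, normalized to the common total mass. -/
theorem couplings_nonempty {r s : 𝒳 → ℝ} (hr : ∀ x, 0 ≤ r x) (hs : ∀ x, 0 ≤ s x)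
    (h : ∑ x, r x = ∑ x, s x) : (couplings r s).Nonempty := by
  have hm : 0 ≤ ∑ x, r x := Finset.sum_nonneg fun x _ => hr x
  refine ⟨fun x y => r x * s y / ∑ x, r x, fun x y => div_nonneg (mul_nonneg (hr x) (hs y)) hm,
    fun x => ?_, fun y => ?_⟩
  · rw [← Finset.sum_div, ← Finset.mul_sum, ← h]
    rcases hm.eq_or_lt with h0 | h0
    · rw [← h0, div_zero]
      exact ((Finset.sum_eq_zero_iff_of_nonneg fun x _ => hr x).1 h0.symm x (by simp)).symm
    · rw [mul_div_cancel_right₀ _ h0.ne']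
  · rw [← Finset.sum_div, ← Finset.sum_mul]
    rcases hm.eq_or_lt with h0 | h0
    · rw [← h0, div_zero]
      exact ((Finset.sum_eq_zero_iff_of_nonneg fun x _ => hs x).1 (h ▸ h0.symm) y (by simp)).symm
    · rw [mul_div_cancel_left₀ _ h0.ne']

/-- The two marginals of a plan that moves no mass between fibres of `f` agree on the fibres. -/
theorem classMass_marginals (f : 𝒳 → 𝒳) {w : 𝒳 → 𝒳 → ℝ} (hw : ∀ x y, f x ≠ f y → w x y = 0)
    (c : 𝒳) : classMass f (fun x => ∑ y, w x y) c = classMass f (fun y => ∑ x, w x y) c := by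
  classical
  unfold classMass
  have h1 : ∀ x, (if f x = c then ∑ y, w x y else 0) = ∑ y, if f x = c then w x y else 0 :=
    fun x => by split_ifs <;> simp
  have h2 : ∀ y, (if f y = c then ∑ x, w x y else 0) = ∑ x, if f y = c then w x y else 0 :=
    fun x => by split_ifs <;> simp
  simp only [h1, h2]
  rw [Finset.sum_comm]
  refine Finset.sum_congr rfl fun y _ => Finset.sum_congr rfl fun x _ => ?_
  by_cases h : f x = f y
  · rw [h]
  · simp [hw x y h]

open Classical in
/-- Along a chain of partitions, each coarser than the one before, a single coupling is optimal
for all of them: it moves between different fibres of `f k` only the total variation distance of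
the images under `f k`. Mass is matched inside the fibres of the finest map first, and the
rest is coupled along the remaining chain. -/
theorem exists_coupling_chain (n : ℕ) : ∀ (f : ℕ → 𝒳 → 𝒳)
    (_ : ∀ k x y, f k x = f k y → f (k + 1) x = f (k + 1) y) {r s : 𝒳 → ℝ}
    (_ : ∀ x, 0 ≤ r x) (_ : ∀ x, 0 ≤ s x) (_ : ∑ x, r x = ∑ x, s x),
    ∃ w ∈ couplings r s, ∀ k < n,
      ∑ x, ∑ y, (if f k x = f k y then 0 else w x y) ≤ classDist (f k) r s / 2 := by
  induction n with
  | zero =>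
    intro f _ r s hr hs h
    obtain ⟨w, hw⟩ := couplings_nonempty hr hs h
    exact ⟨w, hw, fun k hk => absurd hk k.not_lt_zero⟩
  | succ n ih =>
    intro f hf r s hr hs h
    obtain ⟨w₀, hw₀, hsupp, hrow, hcol, hrest⟩ := exists_matching (f 0) hr hs
    have hchain : ∀ k x y, f 0 x = f 0 y → f k x = f k y := fun k => by
      induction k with
      | zero => exact fun x y h => h
      | succ k ihk => exact fun x y h => hf k x y (ihk x y h)
    obtain ⟨w, ⟨hw, hwr, hws⟩, hwk⟩ := ih (fun k => f (k + 1)) (fun k => hf (k + 1))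
      (r := fun x => r x - ∑ y, w₀ x y) (s := fun y => s y - ∑ x, w₀ x y)
      (fun x => sub_nonneg.2 (hrow x)) (fun y => sub_nonneg.2 (hcol y)) (by
        rw [Finset.sum_sub_distrib, Finset.sum_sub_distrib, h, Finset.sum_comm])
    refine ⟨fun x y => w₀ x y + w x y, ⟨fun x y => add_nonneg (hw₀ x y) (hw x y), fun x => ?_,
      fun y => ?_⟩, fun k hk => ?_⟩
    · rw [Finset.sum_add_distrib, hwr]; ring
    · rw [Finset.sum_add_distrib, hws]; ring
    have hterm : ∀ x y, (if f k x = f k y then 0 else w₀ x y + w x y)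
        = if f k x = f k y then 0 else w x y := fun x y => by
      split_ifs with hxy
      · rfl
      · rw [hsupp x y fun h0 => hxy (hchain k x y h0), zero_add]
    simp only [hterm]
    rcases k with _ | k
    · rw [← sum_posPart_classMass (f 0) h]
      refine le_trans ?_ hrest
      refine Finset.sum_le_sum fun x _ => ?_
      refine le_trans ?_ (hwr x).le
      exact Finset.sum_le_sum fun y _ => by split_ifs <;> simp [hw x y]
    · refine (hwk k (by omega)).trans (le_of_eq ?_)
      unfold classDist
      congr 1
      refine Finset.sum_congr rfl fun c _ => ?_
      rw [classMass_sub, classMass_sub, classMass_marginals (f (k + 1)) fun x y hxy =>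
        hsupp x y fun h0 => hxy (hchain (k + 1) x y h0)]
      congr 1
      ring

end Chain

/-! ### The triangle inequality for the Wasserstein distance -/

section Wasserstein

variable {𝒳 : Type*} [Fintype 𝒳] [MetricSpace 𝒳] {p : ℝ} {a b c : 𝒳 → ℝ}

theorem transportCost_nonneg (p : ℝ) {w : 𝒳 → 𝒳 → ℝ} (hw : w ∈ couplings a b) :
    0 ≤ transportCost p w :=
  Finset.sum_nonneg fun x _ => Finset.sum_nonneg fun y _ =>
    mul_nonneg (Real.rpow_nonneg dist_nonneg _) (hw.1 x y)

theorem minTransportCost_nonneg (p : ℝ) (a b : 𝒳 → ℝ) : 0 ≤ minTransportCost p a b :=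
  Real.sInf_nonneg fun _ ⟨_, hw, h⟩ => h ▸ transportCost_nonneg p hw

theorem minTransportCost_le {w : 𝒳 → 𝒳 → ℝ} (hw : w ∈ couplings a b) :
    minTransportCost p a b ≤ transportCost p w :=
  csInf_le ⟨0, fun _ ⟨_, hw, h⟩ => h ▸ transportCost_nonneg p hw⟩ ⟨w, hw, rfl⟩

theorem minTransportCost_comm (p : ℝ) (a b : 𝒳 → ℝ) :
    minTransportCost p a b = minTransportCost p b a := by
  have key : ∀ a b : 𝒳 → ℝ,
      transportCost p '' couplings a b ⊆ transportCost p '' couplings b a := by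
    rintro a b _ ⟨w, hw, rfl⟩
    refine ⟨fun x y => w y x, ⟨fun x y => hw.1 y x, hw.2.2, hw.2.1⟩, ?_⟩
    unfold transportCost
    rw [Finset.sum_comm]
    simp only [dist_comm]
  unfold minTransportCost
  rw [(key a b).antisymm (key b a)]

theorem wasserstein_comm (p : ℝ) (a b : 𝒳 → ℝ) : wasserstein p a b = wasserstein p b a := by
  rw [wasserstein, wasserstein, minTransportCost_comm]

/-- The triangle inequality: two plans are glued along their common marginal `b`, and
Minkowski's inequality is applied to the glued measure on triples of points. -/
theorem wasserstein_triangle (hp : 1 ≤ p) (ha : a ∈ stdSimplex ℝ 𝒳) (hb : b ∈ stdSimplex ℝ 𝒳)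
    (hc : c ∈ stdSimplex ℝ 𝒳) :
    wasserstein p a c ≤ wasserstein p a b + wasserstein p b c := by
  have hp0 : p ≠ 0 := by linarith
  obtain ⟨u, hu, hu'⟩ := (isLeast_minTransportCost p ha hb).1
  obtain ⟨v, hv, hv'⟩ := (isLeast_minTransportCost p hb hc).1
  -- where `b` vanishes, so do the plans, and the value `0 / 0 = 0` is the right one
  set m : 𝒳 → 𝒳 → 𝒳 → ℝ := fun x y z => u x y * v y z / b y with hm
  have hm0 : ∀ x y z, 0 ≤ m x y z := fun x y z =>
    div_nonneg (mul_nonneg (hu.1 x y) (hv.1 y z)) (hb.1 y)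
  have hm1 : ∀ x y, ∑ z, m x y z = u x y := fun x y => by
    rw [hm, ← Finset.sum_div, ← Finset.mul_sum, hv.2.1]
    rcases (hb.1 y).eq_or_lt with h | h
    · have : u x y = 0 := by
        have h1 := hu.2.2 y
        rw [← h] at h1
        exact (Finset.sum_eq_zero_iff_of_nonneg fun x _ => hu.1 x y).1 h1 x (Finset.mem_univ x)
      rw [this]; simp
    · rw [mul_div_cancel_right₀ _ h.ne']
  have hm2 : ∀ y z, ∑ x, m x y z = v y z := fun y z => by
    rw [hm, ← Finset.sum_div, ← Finset.sum_mul, hu.2.2]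
    rcases (hb.1 y).eq_or_lt with h | h
    · have : v y z = 0 := by
        have h1 := hv.2.1 y
        rw [← h] at h1
        exact (Finset.sum_eq_zero_iff_of_nonneg fun z _ => hv.1 y z).1 h1 z (Finset.mem_univ z)
      rw [this]; simp
    · rw [mul_div_cancel_left₀ _ h.ne']
  have hw : (fun x z => ∑ y, m x y z) ∈ couplings a c := by
    refine ⟨fun x z => Finset.sum_nonneg fun y _ => hm0 x y z, fun x => ?_, fun z => ?_⟩
    · rw [Finset.sum_comm]
      simp only [hm1]
      exact hu.2.1 x
    · rw [Finset.sum_comm]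
      simp only [hm2]
      exact hv.2.2 z
  -- the weights are distributed over the two functions of Minkowski's inequality
  set φ : 𝒳 × 𝒳 × 𝒳 → ℝ := fun t => m t.1 t.2.1 t.2.2 ^ (1 / p) with hφ
  have hφ0 : ∀ t, 0 ≤ φ t := fun t => Real.rpow_nonneg (hm0 _ _ _) _
  have hpow : ∀ (t : 𝒳 × 𝒳 × 𝒳) (d : ℝ), 0 ≤ d →
      |φ t * d| ^ p = d ^ p * m t.1 t.2.1 t.2.2 := fun t d hd => by
    rw [abs_of_nonneg (mul_nonneg (hφ0 t) hd), Real.mul_rpow (hφ0 t) hd, hφ,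
      ← Real.rpow_mul (hm0 _ _ _), one_div_mul_cancel hp0, Real.rpow_one, mul_comm]
  have key := Real.Lp_add_le (Finset.univ : Finset (𝒳 × 𝒳 × 𝒳))
    (fun t => φ t * dist t.1 t.2.1) (fun t => φ t * dist t.2.1 t.2.2) hp
  have e1 : ∑ t : 𝒳 × 𝒳 × 𝒳, |φ t * dist t.1 t.2.1| ^ p = minTransportCost p a b := by
    rw [← hu']
    simp only [hpow _ _ dist_nonneg, Fintype.sum_prod_type, ← Finset.mul_sum, hm1]
    rfl
  have e2 : ∑ t : 𝒳 × 𝒳 × 𝒳, |φ t * dist t.2.1 t.2.2| ^ p = minTransportCost p b c := by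
    rw [← hv']
    simp only [hpow _ _ dist_nonneg, Fintype.sum_prod_type]
    rw [Finset.sum_comm]
    refine Finset.sum_congr rfl fun y _ => ?_
    rw [Finset.sum_comm]
    simp only [← Finset.mul_sum, hm2]
  rw [e1, e2] at key
  refine le_trans ?_ key
  refine Real.rpow_le_rpow (minTransportCost_nonneg p a c) ((minTransportCost_le hw).trans ?_)
    (by positivity)
  simp only [← mul_add, hpow _ _ (add_nonneg dist_nonneg dist_nonneg), Fintype.sum_prod_type,
    transportCost, Finset.mul_sum]
  refine Finset.sum_le_sum fun x _ => ?_
  rw [Finset.sum_comm]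
  exact Finset.sum_le_sum fun y _ => Finset.sum_le_sum fun z _ =>
    mul_le_mul_of_nonneg_right (Real.rpow_le_rpow dist_nonneg (dist_triangle x y z) (by linarith))
      (hm0 x y z)

theorem abs_wasserstein_sub_le (hp : 1 ≤ p) {r s r' s' : 𝒳 → ℝ} (hr : r ∈ stdSimplex ℝ 𝒳)
    (hs : s ∈ stdSimplex ℝ 𝒳) (hr' : r' ∈ stdSimplex ℝ 𝒳) (hs' : s' ∈ stdSimplex ℝ 𝒳) :
    |wasserstein p r' s' - wasserstein p r s| ≤ wasserstein p r' r + wasserstein p s' s := by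
  have h1 := wasserstein_triangle hp hr' hr hs'
  have h2 := wasserstein_triangle hp hr hs hs'
  have h3 := wasserstein_triangle hp hr hr' hs
  have h4 := wasserstein_triangle hp hr' hs' hs
  rw [wasserstein_comm p r r'] at h3
  rw [wasserstein_comm p s s'] at h2
  rw [abs_le]
  constructor <;> linarith

end Wasserstein

/-! ### Hierarchies of nets and the bound on the transport cost -/

section Nets

variable {𝒳 : Type*} [Fintype 𝒳] [MetricSpace 𝒳]

theorem diam_nonneg (𝒳 : Type*) [MetricSpace 𝒳] : 0 ≤ diam 𝒳 := Metric.diam_nonneg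

theorem dist_le_diam (x y : 𝒳) : dist x y ≤ diam 𝒳 :=
  Metric.dist_le_diam_of_mem (Set.finite_univ.isBounded) (Set.mem_univ x) (Set.mem_univ y)

theorem exists_net {δ : ℝ} (hδ : 0 ≤ δ) : ∃ (π : 𝒳 → 𝒳) (C : Finset 𝒳),
    (∀ x, π x ∈ C) ∧ (∀ x, dist x (π x) ≤ δ) ∧ C.card = coveringNumber 𝒳 δ := by
  have hfin : Metric.coveringNumber δ.toNNReal (Set.univ : Set 𝒳) ≠ ⊤ := by
    refine ne_top_of_le_ne_top ?_ (Metric.coveringNumber_le_encard_self _)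
    exact Set.encard_ne_top_iff.2 Set.finite_univ
  obtain ⟨C, -, hC, hcov, hcard⟩ := Metric.exists_set_encard_eq_coveringNumber hfin
  have hnear : ∀ x, ∃ y ∈ C, dist x y ≤ δ := fun x => by
    have hx := Metric.isCover_iff_subset_iUnion_closedBall.1 hcov (Set.mem_univ x)
    simp only [Set.mem_iUnion, Metric.mem_closedBall, Real.coe_toNNReal δ hδ] at hx
    obtain ⟨y, hy, hxy⟩ := hx
    exact ⟨y, hy, hxy⟩
  choose π hπ hd using hnear
  refine ⟨π, hC.toFinset, fun x => hC.mem_toFinset.2 (hπ x), hd, ?_⟩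
  rw [coveringNumber, ← hcard, hC.encard_eq_coe_toFinset_card, ENat.toNat_natCast]

/-- A hierarchy of nets of radii `q ^ (k - L) * diam 𝒳`, in the order from fine to coarse:
`g 0 = id`, and `g (k + 1) x` is a point of the net of radius `q ^ (k - L) * diam 𝒳` within this
radius of `g k x`.
The geometric series of the radii bounds the distance from `x` to its ancestor `g k x`. -/
theorem exists_hierarchy (𝒳 : Type*) [Fintype 𝒳] [MetricSpace 𝒳] {q : ℕ} (hq : 2 ≤ q) (L : ℕ) :
    ∃ (g : ℕ → 𝒳 → 𝒳) (C : ℕ → Finset 𝒳),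
      (∀ k x, g k x ∈ C k) ∧ (∀ x, g 0 x = x) ∧
      (∀ k x y, g k x = g k y → g (k + 1) x = g (k + 1) y) ∧
      (∀ k x, dist x (g k x) ≤ (q : ℝ) ^ ((k : ℝ) - L) * diam 𝒳) ∧
      (C 0).card = Fintype.card 𝒳 ∧
      ∀ k, (C (k + 1)).card = coveringNumber 𝒳 ((q : ℝ) ^ ((k : ℝ) - L) * diam 𝒳) := by
  have hq2 : (2 : ℝ) ≤ q := by exact_mod_cast hq
  have hq0 : (0 : ℝ) < q := by linarith
  have hρ : ∀ k : ℕ, 0 ≤ (q : ℝ) ^ ((k : ℝ) - L) * diam 𝒳 := fun k =>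
    mul_nonneg (Real.rpow_nonneg hq0.le _) (diam_nonneg 𝒳)
  choose π C hC hd hcard using fun k : ℕ => exists_net (𝒳 := 𝒳) (hρ k)
  refine ⟨fun k => Nat.rec id (fun k g => π k ∘ g) k,
    fun k => Nat.rec Finset.univ (fun k _ => C k) k, ?_, fun x => rfl, ?_, ?_, rfl, hcard⟩
  · rintro (_ | k) x
    · exact Finset.mem_univ _
    · exact hC k _
  · exact fun k x y h => congrArg (π k) h
  · intro k x
    induction k with
    | zero => simpa using hρ 0
    | succ k ih =>
      refine (dist_triangle _ _ _).trans ((add_le_add ih (hd k _)).trans ?_)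
      have hstep : (q : ℝ) ^ (((k + 1 : ℕ) : ℝ) - L) = q ^ ((k : ℝ) - L) * q := by
        rw [← Real.rpow_add_one hq0.ne']
        congr 1
        push_cast
        ring
      rw [hstep]
      nlinarith [hρ k]

/-- Two points that are separated at some level of the hierarchy have a distance of the order of
the radius of the coarsest level that separates them. -/
theorem dist_rpow_le_sum {p : ℝ} (hp : 1 ≤ p) {q : ℕ} (hq : 2 ≤ q) (L : ℕ) {g : ℕ → 𝒳 → 𝒳}
    (hg0 : ∀ x, g 0 x = x)
    (hd : ∀ k x, dist x (g k x) ≤ (q : ℝ) ^ ((k : ℝ) - L) * diam 𝒳) (x y : 𝒳)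
    [∀ k, Decidable (g k x = g k y)] :
    dist x y ^ p ≤ ∑ k ∈ Finset.range (L + 1),
      if g k x = g k y then 0 else (2 * ((q : ℝ) ^ ((k : ℝ) + 1 - L) * diam 𝒳)) ^ p := by
  classical
  have hq2 : (2 : ℝ) ≤ q := by exact_mod_cast hq
  have hq0 : (0 : ℝ) < q := by linarith
  have hρ : ∀ t : ℝ, 0 ≤ 2 * ((q : ℝ) ^ t * diam 𝒳) := fun t =>
    mul_nonneg zero_le_two (mul_nonneg (Real.rpow_nonneg hq0.le _) (diam_nonneg 𝒳))
  have hnn : ∀ k ∈ Finset.range (L + 1),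
      0 ≤ if g k x = g k y then 0 else (2 * ((q : ℝ) ^ ((k : ℝ) + 1 - L) * diam 𝒳)) ^ p :=
    fun k _ => by split_ifs <;> [exact le_rfl; exact Real.rpow_nonneg (hρ _) _]
  by_cases hxy : x = y
  · subst hxy
    rw [dist_self, Real.zero_rpow (by linarith)]
    exact Finset.sum_nonneg hnn
  obtain ⟨k, hkL, hk, hle⟩ : ∃ k ≤ L, g k x ≠ g k y ∧
      dist x y ≤ 2 * ((q : ℝ) ^ ((k : ℝ) + 1 - L) * diam 𝒳) := by
    have h0 : g 0 x ≠ g 0 y := by rwa [hg0, hg0]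
    have hspec := Nat.findGreatest_spec (P := fun k => g k x ≠ g k y) (Nat.zero_le L) h0
    refine ⟨Nat.findGreatest (fun k => g k x ≠ g k y) L, Nat.findGreatest_le L, hspec, ?_⟩
    have hkL : Nat.findGreatest (fun k => g k x ≠ g k y) L ≤ L := Nat.findGreatest_le L
    set k := Nat.findGreatest (fun k => g k x ≠ g k y) L with hkdef
    rcases hkL.eq_or_lt with hkL | hkL
    · -- points separated by the coarsest net: here the diameter itself is the bound
      rw [hkL, add_sub_cancel_left, Real.rpow_one]
      nlinarith [dist_le_diam x y, diam_nonneg 𝒳]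
    · have heq : g (k + 1) x = g (k + 1) y := by
        by_contra hne
        exact absurd (Nat.le_findGreatest (P := fun k => g k x ≠ g k y) hkL hne) (by omega)
      have h1 := hd (k + 1) x
      have h2 := hd (k + 1) y
      rw [← heq] at h2
      push_cast at h1 h2
      have h3 := dist_triangle_right x y (g (k + 1) x)
      linarith
  refine (Real.rpow_le_rpow dist_nonneg hle (by linarith)).trans ?_
  have := Finset.single_le_sum hnn (Finset.mem_range.2 (Nat.lt_succ_of_le hkL))
  rwa [if_neg hk] at this

/-- The optimal transport cost is bounded by the distances of the images of the two measures in
the levels of a hierarchy of nets; the weighted sum of the roots of the sizes of these nets is the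
constant `errorConst`. -/
theorem exists_minTransportCost_le_sum (𝒳 : Type*) [Fintype 𝒳] [MetricSpace 𝒳] {p : ℝ}
    (hp : 1 ≤ p) {q : ℕ} (hq : 2 ≤ q) (L : ℕ) :
    ∃ (A : ℕ → ℝ) (g : ℕ → 𝒳 → 𝒳) (C : ℕ → Finset 𝒳),
      (∀ k, 0 ≤ A k) ∧ (∀ k x, g k x ∈ C k) ∧
      (∀ r ∈ stdSimplex ℝ 𝒳, ∀ s ∈ stdSimplex ℝ 𝒳,
        minTransportCost p r s ≤ ∑ k ∈ Finset.range (L + 1), A k * classDist (g k) r s) ∧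
      ∑ k ∈ Finset.range (L + 1), A k * √((C k).card : ℝ) ≤ errorConst 𝒳 p q L := by
  classical
  have hq2 : (2 : ℝ) ≤ q := by exact_mod_cast hq
  have hq0 : (0 : ℝ) < q := by linarith
  have hD := diam_nonneg 𝒳
  obtain ⟨g, C, hC, hg0, hg, hd, hC0, hCk⟩ := exists_hierarchy 𝒳 hq L
  set A : ℕ → ℝ := fun k =>
    2 ^ (p - 1) * (q : ℝ) ^ (2 * p) * diam 𝒳 ^ p * (q : ℝ) ^ (((k : ℝ) - 1 - L) * p) with hA
  have hA2 : ∀ k : ℕ, (2 * ((q : ℝ) ^ ((k : ℝ) + 1 - L) * diam 𝒳)) ^ p = 2 * A k := fun k => by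
    rw [Real.mul_rpow zero_le_two (mul_nonneg (Real.rpow_nonneg hq0.le _) hD),
      Real.mul_rpow (Real.rpow_nonneg hq0.le _) hD, ← Real.rpow_mul hq0.le, hA]
    have e1 : (2 : ℝ) ^ p = 2 * 2 ^ (p - 1) := by
      rw [Real.rpow_sub_one two_ne_zero]; ring
    have e2 : (q : ℝ) ^ (((k : ℝ) + 1 - L) * p)
        = (q : ℝ) ^ (2 * p) * (q : ℝ) ^ (((k : ℝ) - 1 - L) * p) := by
      rw [← Real.rpow_add hq0]; congr 1; ring
    rw [e1, e2]; ring
  refine ⟨A, g, C, fun k => by positivity, hC, fun r hr s hs => ?_, ?_⟩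
  · obtain ⟨w, hw, hwk⟩ := exists_coupling_chain (L + 1) g hg hr.1 hs.1 (hr.2.trans hs.2.symm)
    refine (minTransportCost_le hw).trans ?_
    calc transportCost p w
        ≤ ∑ x, ∑ y, ∑ k ∈ Finset.range (L + 1),
            2 * A k * (if g k x = g k y then 0 else w x y) := by
          refine Finset.sum_le_sum fun x _ => Finset.sum_le_sum fun y _ => ?_
          refine (mul_le_mul_of_nonneg_right (dist_rpow_le_sum hp hq L hg0 hd x y)
            (hw.1 x y)).trans (le_of_eq ?_)
          rw [Finset.sum_mul]
          refine Finset.sum_congr rfl fun k _ => ?_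
          rw [hA2]
          split_ifs <;> ring
      _ = ∑ k ∈ Finset.range (L + 1),
            2 * A k * ∑ x, ∑ y, (if g k x = g k y then 0 else w x y) := by
          simp only [Finset.mul_sum]
          rw [Finset.sum_comm' (t' := Finset.univ) (s' := fun _ => Finset.univ) (by simp)]
          rw [Finset.sum_congr rfl fun x _ => Finset.sum_comm, Finset.sum_comm]
          refine Finset.sum_congr rfl fun k _ => ?_
          rw [Finset.sum_comm]
      _ ≤ ∑ k ∈ Finset.range (L + 1), A k * classDist (g k) r s := by
          refine Finset.sum_le_sum fun k hk => ?_
          have hAk : 0 ≤ A k := by positivity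
          calc _ ≤ 2 * A k * (classDist (g k) r s / 2) :=
                mul_le_mul_of_nonneg_left (hwk k (Finset.mem_range.1 hk)) (by positivity)
            _ = _ := by ring
  · rw [errorConst]
    set K : ℝ := 2 ^ (p - 1) * (q : ℝ) ^ (2 * p) * diam 𝒳 ^ p with hK
    have hK0 : 0 ≤ K := by positivity
    simp only [hA, mul_assoc K]
    rw [← Finset.mul_sum]
    refine mul_le_mul_of_nonneg_left ?_ hK0
    rw [Finset.sum_range_succ', add_comm]
    refine add_le_add (le_of_eq ?_) ?_
    · rw [hC0]
      congr 2
      push_cast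
      ring
    -- the level `k + 1` of the hierarchy carries the net of index `l = L - k`
    set F : ℕ → ℝ := fun l =>
      (q : ℝ) ^ (-((l : ℝ) * p)) * √(coveringNumber 𝒳 ((q : ℝ) ^ (-(l : ℝ)) * diam 𝒳) : ℝ) with hF
    have hF0 : 0 ≤ F 0 := by positivity
    rw [Finset.sum_range_succ' F, ← Finset.sum_range_reflect fun l => F (l + 1)]
    refine (Finset.sum_le_sum fun k hk => le_of_eq ?_).trans (le_add_of_nonneg_right hF0)
    have hk' : ((L - 1 - k + 1 : ℕ) : ℝ) = L - k := by
      have hkL := Finset.mem_range.1 hk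
      rw [show L - 1 - k + 1 = L - k by omega, Nat.cast_sub hkL.le]
    simp only [hF, hk', hCk]
    push_cast
    congr 2
    · ring
    · congr 4
      ring

end Nets

/-! ### Second moments of empirical measures -/

section Sampling

variable {𝒳 : Type*} [Fintype 𝒳]

theorem empirical_mem_stdSimplex {S : ℕ} (hS : 1 ≤ S) (x : Fin S → 𝒳) :
    empirical x ∈ stdSimplex ℝ 𝒳 := by
  classical
  have hS0 : (S : ℝ) ≠ 0 := by positivity
  refine ⟨fun a => by unfold empirical; positivity, ?_⟩
  unfold empirical
  rw [← Finset.sum_div, ← Nat.cast_sum,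
    ← Finset.card_eq_sum_card_fiberwise (s := Finset.univ) (f := x) (fun _ _ => Finset.mem_univ _)]
  simp [hS0]

open Classical in
theorem classMass_empirical {S : ℕ} (f : 𝒳 → 𝒳) (x : Fin S → 𝒳) (c : 𝒳) :
    classMass f (empirical x) c = (S : ℝ)⁻¹ * ∑ k, if f (x k) = c then 1 else 0 := by
  unfold classMass empirical
  have h : ∀ a, (if f a = c then ((Finset.univ.filter fun k => x k = a).card : ℝ) / S else 0)
      = (S : ℝ)⁻¹ * ∑ k, if x k = a then (if f a = c then 1 else 0) else 0 := fun a => by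
    split_ifs
    · rw [Finset.card_filter]
      push_cast
      ring
    · simp
  simp only [h]
  rw [← Finset.mul_sum, Finset.sum_comm]
  simp

/-- The Cauchy-Schwarz inequality for the at most `C.card` many nonempty fibres. -/
theorem classDist_sq_le {f : 𝒳 → 𝒳} {C : Finset 𝒳} (hC : ∀ x, f x ∈ C) (r s : 𝒳 → ℝ) :
    classDist f r s ^ 2 ≤ C.card * ∑ c, (classMass f r c - classMass f s c) ^ 2 := by
  classical
  have h0 : ∀ (r : 𝒳 → ℝ), ∀ c ∉ C, classMass f r c = 0 := fun r c hc =>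
    Finset.sum_eq_zero fun x _ => if_neg fun h : f x = c => hc (h ▸ hC x)
  have h1 : classDist f r s = ∑ c ∈ C, |classMass f r c - classMass f s c| :=
    (Finset.sum_subset (Finset.subset_univ C) fun c _ hc => by simp [h0 _ c hc]).symm
  rw [h1]
  refine sq_sum_le_card_mul_sum_sq.trans (mul_le_mul_of_nonneg_left ?_ (Nat.cast_nonneg _))
  simp only [sq_abs]
  exact Finset.sum_le_univ_sum_of_nonneg fun c => sq_nonneg _

variable [MeasurableSpace 𝒳] [MeasurableSingletonClass 𝒳]
  {Ω : Type*} [MeasurableSpace Ω] {μ : Measure Ω} [IsProbabilityMeasure μ]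

theorem integrable_comp_of_finite {E : Type*} [Finite E] [MeasurableSpace E]
    [MeasurableSingletonClass E] (F : E → ℝ) {Z : Ω → E} (hZ : Measurable Z) :
    Integrable (fun ω => F (Z ω)) μ :=
  have : IsFiniteMeasure (μ.map Z) := inferInstance
  (Integrable.of_finite (μ := μ.map Z) (f := F)).comp_measurable hZ

theorem integral_comp_of_law {r : 𝒳 → ℝ} {Z : Ω → 𝒳} (hZ : Measurable Z)
    (hlaw : ∀ a, μ.real (Z ⁻¹' {a}) = r a) (F : 𝒳 → ℝ) :
    ∫ ω, F (Z ω) ∂μ = ∑ a, r a * F a := by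
  have : IsFiniteMeasure (μ.map Z) := inferInstance
  rw [← integral_map hZ.aemeasurable (Measurable.of_discrete (f := F)).aestronglyMeasurable,
    integral_fintype Integrable.of_finite]
  refine Finset.sum_congr rfl fun a _ => ?_
  rw [map_measureReal_apply hZ (measurableSet_singleton a), hlaw, smul_eq_mul]

/-- The mean squared deviation of the empirical mass of a fibre is the variance of a mean of `S`
independent indicators. -/
theorem integral_classMass_empirical_sub_sq_le {S : ℕ} (hS : 1 ≤ S) {r : 𝒳 → ℝ}
    {X : Fin S → Ω → 𝒳} (hX : ∀ k, Measurable (X k))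
    (hlaw : ∀ k a, μ.real (X k ⁻¹' {a}) = r a)
    (hindep : iIndepFun X μ) (f : 𝒳 → 𝒳) (c : 𝒳) :
    ∫ ω, (classMass f (empirical fun k => X k ω) c - classMass f r c) ^ 2 ∂μ
      ≤ classMass f r c / S := by
  classical
  have hS0 : (S : ℝ) ≠ 0 := by positivity
  set I : 𝒳 → ℝ := fun x => if f x = c then 1 else 0 with hI
  have hImeas : Measurable I := Measurable.of_discrete
  have hmean : ∀ k, ∫ ω, I (X k ω) ∂μ = classMass f r c := fun k => by
    rw [integral_comp_of_law (hX k) (hlaw k), classMass]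
    exact Finset.sum_congr rfl fun a _ => by simp [hI]
  have hLp : ∀ k, MemLp (I ∘ X k) 2 μ := fun k => by
    rw [memLp_two_iff_integrable_sq (hImeas.comp (hX k)).aestronglyMeasurable]
    exact integrable_comp_of_finite (fun x => I x ^ 2) (hX k)
  have hvar : ∀ k, Var[I ∘ X k; μ] ≤ classMass f r c := fun k => by
    refine (variance_le_expectation_sq (hImeas.comp (hX k)).aestronglyMeasurable).trans ?_
    rw [← hmean k]
    refine le_of_eq (integral_congr_ae (.of_forall fun ω => ?_))
    simp only [hI, Pi.pow_apply, Function.comp_apply]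
    split_ifs <;> simp
  have hsum : Var[∑ k, I ∘ X k; μ] ≤ S * classMass f r c := by
    rw [IndepFun.variance_sum (fun k _ => hLp k) fun i _ j _ hij =>
      (hindep.indepFun hij).comp hImeas hImeas]
    refine (Finset.sum_le_card_nsmul _ _ _ fun k _ => hvar k).trans (le_of_eq ?_)
    simp
  have hZ : (fun ω => classMass f (empirical fun k => X k ω) c)
      = fun ω => (S : ℝ)⁻¹ * (∑ k, I ∘ X k) ω := by
    funext ω
    simp [classMass_empirical, hI]
  have hZmean : ∫ ω, classMass f (empirical fun k => X k ω) c ∂μ = classMass f r c := by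
    rw [hZ]
    simp only [Finset.sum_apply, Function.comp_apply]
    rw [integral_const_mul, integral_finsetSum _ fun k _ => integrable_comp_of_finite I (hX k)]
    simp only [hmean, Finset.sum_const, Finset.card_univ, Fintype.card_fin, nsmul_eq_mul]
    field_simp
  have hZmeas : Measurable fun ω => classMass f (empirical fun k => X k ω) c := by
    rw [hZ]
    simp only [Finset.sum_apply]
    exact (Finset.measurable_sum _ fun k _ => hImeas.comp (hX k)).const_mul _
  have := variance_eq_integral (μ := μ) hZmeas.aemeasurable
  rw [hZmean] at this
  rw [← this, hZ, variance_const_mul]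
  calc ((S : ℝ)⁻¹) ^ 2 * Var[∑ k, I ∘ X k; μ]
      ≤ ((S : ℝ)⁻¹) ^ 2 * (S * classMass f r c) := mul_le_mul_of_nonneg_left hsum (by positivity)
    _ = classMass f r c / S := by field_simp

theorem integral_classDist_empirical_sq_le {S : ℕ} (hS : 1 ≤ S) {r : 𝒳 → ℝ}
    (hr : r ∈ stdSimplex ℝ 𝒳) {X : Fin S → Ω → 𝒳} (hX : ∀ k, Measurable (X k))
    (hlaw : ∀ k a, μ.real (X k ⁻¹' {a}) = r a) (hindep : iIndepFun X μ) {f : 𝒳 → 𝒳}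
    {C : Finset 𝒳} (hC : ∀ x, f x ∈ C) :
    ∫ ω, classDist f (empirical fun k => X k ω) r ^ 2 ∂μ ≤ C.card / S := by
  have hmeas : Measurable fun ω k => X k ω := measurable_pi_lambda _ hX
  have hint : ∀ c, Integrable
      (fun ω => (classMass f (empirical fun k => X k ω) c - classMass f r c) ^ 2) μ := fun c =>
    integrable_comp_of_finite
      (fun x : Fin S → 𝒳 => (classMass f (empirical x) c - classMass f r c) ^ 2) hmeas
  calc ∫ ω, classDist f (empirical fun k => X k ω) r ^ 2 ∂μ
      ≤ ∫ ω, C.card * ∑ c, (classMass f (empirical fun k => X k ω) c - classMass f r c) ^ 2 ∂μ :=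
        integral_mono
          (integrable_comp_of_finite (fun x : Fin S → 𝒳 => classDist f (empirical x) r ^ 2) hmeas)
          ((integrable_finsetSum _ fun c _ => hint c).const_mul _)
          fun ω => classDist_sq_le hC _ _
    _ = C.card * ∑ c, ∫ ω, (classMass f (empirical fun k => X k ω) c - classMass f r c) ^ 2 ∂μ := by
        rw [integral_const_mul, integral_finsetSum _ fun c _ => hint c]
    _ ≤ C.card * ∑ c, classMass f r c / S := by
        gcongr with c
        exact integral_classMass_empirical_sub_sq_le hS hX hlaw hindep f c
    _ = C.card / S := by
        rw [← Finset.sum_div, sum_classMass, hr.2]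
        ring

end Sampling

/-! ### The mean squared error -/

section MeanSquaredError

variable {𝒳 : Type*} [Fintype 𝒳] [MetricSpace 𝒳]

theorem errorConst_nonneg (p : ℝ) (q L : ℕ) : 0 ≤ errorConst 𝒳 p q L := by
  have := diam_nonneg 𝒳
  unfold errorConst
  positivity

/-- The squared error of an average of repetitions is at most the average of the squared errors,
and each of these is controlled by the triangle inequality. -/
theorem abs_estimator_sub_sq_le {p : ℝ} (hp : 1 ≤ p) {r s : 𝒳 → ℝ} (hr : r ∈ stdSimplex ℝ 𝒳)
    (hs : s ∈ stdSimplex ℝ 𝒳) {B S : ℕ} (hB : 1 ≤ B) (hS : 1 ≤ S) (x y : Fin B → Fin S → 𝒳) :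
    |estimator p x y - wasserstein p r s| ^ 2 ≤ (B : ℝ)⁻¹ * ∑ i,
      (2 * wasserstein p (empirical (x i)) r ^ 2 + 2 * wasserstein p (empirical (y i)) s ^ 2) := by
  have hB0 : (B : ℝ) ≠ 0 := by positivity
  have h1 : estimator p x y - wasserstein p r s = (B : ℝ)⁻¹ *
      ∑ i, (wasserstein p (empirical (x i)) (empirical (y i)) - wasserstein p r s) := by
    rw [estimator, Finset.sum_sub_distrib, mul_sub]
    simp [hB0]
  rw [sq_abs, h1, mul_pow, sq (B : ℝ)⁻¹, mul_assoc]
  refine mul_le_mul_of_nonneg_left ?_ (by positivity)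
  have h2 := sq_sum_le_card_mul_sum_sq (s := (Finset.univ : Finset (Fin B)))
    (f := fun i => wasserstein p (empirical (x i)) (empirical (y i)) - wasserstein p r s)
  rw [Finset.card_univ, Fintype.card_fin] at h2
  refine (mul_le_mul_of_nonneg_left h2 (by positivity)).trans ?_
  rw [inv_mul_cancel_left₀ hB0]
  refine Finset.sum_le_sum fun i _ => ?_
  have h3 := abs_wasserstein_sub_le hp hr hs (empirical_mem_stdSimplex hS (x i))
    (empirical_mem_stdSimplex hS (y i))
  have h4 := pow_le_pow_left₀ (abs_nonneg _) h3 2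
  rw [sq_abs] at h4
  nlinarith [sq_nonneg (wasserstein p (empirical (x i)) r - wasserstein p (empirical (y i)) s)]

variable [MeasurableSpace 𝒳] [MeasurableSingletonClass 𝒳]
  {Ω : Type*} [MeasurableSpace Ω] {μ : Measure Ω} [IsProbabilityMeasure μ]

/-- The second moment of the transport cost between a measure and its empirical measure: the
levels of the hierarchy are combined by the Cauchy-Schwarz inequality with weights chosen such that
the result is that of Minkowski's inequality in `L²`. -/
theorem integral_minTransportCost_empirical_sq_le {p : ℝ} (hp : 1 ≤ p) {S : ℕ} (hS : 1 ≤ S)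
    {r : 𝒳 → ℝ} (hr : r ∈ stdSimplex ℝ 𝒳) {X : Fin S → Ω → 𝒳} (hX : ∀ k, Measurable (X k))
    (hlaw : ∀ k a, μ.real (X k ⁻¹' {a}) = r a) (hindep : iIndepFun X μ)
    {q : ℕ} (hq : 2 ≤ q) (L : ℕ) :
    ∫ ω, minTransportCost p (empirical fun k => X k ω) r ^ 2 ∂μ
      ≤ errorConst 𝒳 p q L ^ 2 / S := by
  obtain ⟨A, g, C, hA, hC, hcost, hE⟩ := exists_minTransportCost_le_sum 𝒳 hp hq L
  have hne : Nonempty 𝒳 := by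
    by_contra h
    rw [not_nonempty_iff] at h
    simpa using hr.2
  have hn : ∀ k, 0 < √((C k).card : ℝ) := fun k =>
    Real.sqrt_pos.2 (Nat.cast_pos.2 (Finset.card_pos.2 ⟨_, hC k hne.some⟩))
  have hmeas : Measurable fun ω k => X k ω := measurable_pi_lambda _ hX
  set R : Finset ℕ := Finset.range (L + 1)
  have hE0 : 0 ≤ ∑ k ∈ R, A k * √((C k).card : ℝ) :=
    Finset.sum_nonneg fun k _ => mul_nonneg (hA k) (hn k).le
  have hpt : ∀ x : Fin S → 𝒳, minTransportCost p (empirical x) r ^ 2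
      ≤ (∑ k ∈ R, A k * √((C k).card : ℝ))
        * ∑ k ∈ R, A k / √((C k).card : ℝ) * classDist (g k) (empirical x) r ^ 2 := fun x => by
    refine (pow_le_pow_left₀ (minTransportCost_nonneg p _ _)
      (hcost _ (empirical_mem_stdSimplex hS x) _ hr) 2).trans ?_
    refine Finset.sum_sq_le_sum_mul_sum_of_sq_le_mul _
      (fun k _ => mul_nonneg (hA k) (hn k).le)
      (fun k _ => mul_nonneg (div_nonneg (hA k) (hn k).le) (sq_nonneg _)) fun k _ => ?_
    have := (hn k).ne'
    refine le_of_eq ?_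
    field_simp
  have hint : ∀ k, Integrable (fun ω => A k / √((C k).card : ℝ)
      * classDist (g k) (empirical fun j => X j ω) r ^ 2) μ := fun k =>
    integrable_comp_of_finite (fun x : Fin S → 𝒳 => A k / √((C k).card : ℝ)
      * classDist (g k) (empirical x) r ^ 2) hmeas
  calc ∫ ω, minTransportCost p (empirical fun k => X k ω) r ^ 2 ∂μ
      ≤ ∫ ω, (∑ k ∈ R, A k * √((C k).card : ℝ)) * ∑ k ∈ R, A k / √((C k).card : ℝ)
          * classDist (g k) (empirical fun j => X j ω) r ^ 2 ∂μ :=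
        integral_mono (integrable_comp_of_finite
          (fun x : Fin S → 𝒳 => minTransportCost p (empirical x) r ^ 2) hmeas)
          ((integrable_finsetSum _ fun k _ => hint k).const_mul _) fun ω => hpt _
    _ = (∑ k ∈ R, A k * √((C k).card : ℝ)) * ∑ k ∈ R, A k / √((C k).card : ℝ)
          * ∫ ω, classDist (g k) (empirical fun j => X j ω) r ^ 2 ∂μ := by
        rw [integral_const_mul, integral_finsetSum _ fun k _ => hint k]
        simp only [integral_const_mul]
    _ ≤ (∑ k ∈ R, A k * √((C k).card : ℝ)) * ∑ k ∈ R, A k / √((C k).card : ℝ)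
          * ((C k).card / S) := by
        refine mul_le_mul_of_nonneg_left (Finset.sum_le_sum fun k _ => ?_) hE0
        exact mul_le_mul_of_nonneg_left
          (integral_classDist_empirical_sq_le hS hr hX hlaw hindep (hC k))
          (div_nonneg (hA k) (hn k).le)
    _ = (∑ k ∈ R, A k * √((C k).card : ℝ)) ^ 2 / S := by
        rw [sq, mul_div_assoc, Finset.sum_div _ _ (S : ℝ)]
        congr 1
        refine Finset.sum_congr rfl fun k _ => ?_
        rw [← mul_div_assoc, div_mul_eq_mul_div, mul_div_assoc (A k), Real.div_sqrt]
    _ ≤ errorConst 𝒳 p q L ^ 2 / S := by gcongr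

/-- Jensen's inequality turns the second moment of the cost `W_p ^ p` into that of `W_p`. -/
theorem integral_wasserstein_empirical_sq_le {p : ℝ} (hp : 1 ≤ p) {S : ℕ} (hS : 1 ≤ S)
    {r : 𝒳 → ℝ} (hr : r ∈ stdSimplex ℝ 𝒳) {X : Fin S → Ω → 𝒳} (hX : ∀ k, Measurable (X k))
    (hlaw : ∀ k a, μ.real (X k ⁻¹' {a}) = r a) (hindep : iIndepFun X μ)
    {q : ℕ} (hq : 2 ≤ q) (L : ℕ) :
    ∫ ω, wasserstein p (empirical fun k => X k ω) r ^ 2 ∂μ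
      ≤ errorConst 𝒳 p q L ^ (2 / p) * (S : ℝ) ^ (-(1 / p)) := by
  have hp0 : 0 < p := by linarith
  have hmeas : Measurable fun ω k => X k ω := measurable_pi_lambda _ hX
  have hE := errorConst_nonneg (𝒳 := 𝒳) p q L
  have hpow : ∀ ω, wasserstein p (empirical fun k => X k ω) r ^ 2
      = (minTransportCost p (empirical fun k => X k ω) r ^ 2) ^ (1 / p) := fun ω => by
    rw [wasserstein, ← Real.rpow_mul_natCast (minTransportCost_nonneg p _ _),
      ← Real.rpow_natCast_mul (minTransportCost_nonneg p _ _), mul_comm]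
  simp only [hpow]
  refine (ConcaveOn.le_map_integral (s := Set.Ici 0) (g := fun t : ℝ => t ^ (1 / p))
    (Real.concaveOn_rpow (by positivity) ((div_le_one hp0).2 hp))
    (Real.continuous_rpow_const (by positivity)).continuousOn isClosed_Ici
    (.of_forall fun ω => Set.mem_Ici.2 (sq_nonneg _))
    (integrable_comp_of_finite
      (fun x : Fin S → 𝒳 => minTransportCost p (empirical x) r ^ 2) hmeas)
    (integrable_comp_of_finite
      (fun x : Fin S → 𝒳 => (minTransportCost p (empirical x) r ^ 2) ^ (1 / p)) hmeas)).trans ?_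
  refine (Real.rpow_le_rpow (integral_nonneg fun ω => sq_nonneg _)
    (integral_minTransportCost_empirical_sq_le hp hS hr hX hlaw hindep hq L)
    (by positivity)).trans (le_of_eq ?_)
  rw [Real.div_rpow (sq_nonneg _) (Nat.cast_nonneg _), Real.rpow_neg (Nat.cast_nonneg _),
    ← Real.rpow_natCast_mul hE, div_eq_mul_inv]
  congr 2
  push_cast
  ring

theorem integrable_abs_estimator_sub_sq (p : ℝ) {r s : 𝒳 → ℝ} {B S : ℕ}
    {X Y : Fin B → Fin S → Ω → 𝒳} (h : IsSample μ r s X Y) :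
    Integrable (fun ω => |estimator p (fun i k => X i k ω) (fun i k => Y i k ω)
      - wasserstein p r s| ^ 2) μ := by
  have hX : Measurable fun ω i k => X i k ω :=
    measurable_pi_lambda _ fun i => measurable_pi_lambda _ fun k => h.measurable_left i k
  have hY : Measurable fun ω i k => Y i k ω :=
    measurable_pi_lambda _ fun i => measurable_pi_lambda _ fun k => h.measurable_right i k
  have hF := integrable_comp_of_finite (μ := μ)
    (fun z : (Fin B → Fin S → 𝒳) × (Fin B → Fin S → 𝒳) =>
      |estimator p z.1 z.2 - wasserstein p r s| ^ 2) (hX.prodMk hY)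
  exact hF

theorem integral_abs_estimator_sub_sq_le {p : ℝ} (hp : 1 ≤ p) {r s : 𝒳 → ℝ}
    (hr : r ∈ stdSimplex ℝ 𝒳) (hs : s ∈ stdSimplex ℝ 𝒳) {B S : ℕ} (hB : 1 ≤ B) (hS : 1 ≤ S)
    {X Y : Fin B → Fin S → Ω → 𝒳} (h : IsSample μ r s X Y) {q : ℕ} (hq : 2 ≤ q) (L : ℕ) :
    ∫ ω, |estimator p (fun i k => X i k ω) (fun i k => Y i k ω) - wasserstein p r s| ^ 2 ∂μ
      ≤ 4 * (errorConst 𝒳 p q L ^ (2 / p) * (S : ℝ) ^ (-(1 / p))) := by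
  have hB0 : (B : ℝ) ≠ 0 := by positivity
  set M := errorConst 𝒳 p q L ^ (2 / p) * (S : ℝ) ^ (-(1 / p))
  have hX : ∀ i, ∫ ω, wasserstein p (empirical fun k => X i k ω) r ^ 2 ∂μ ≤ M := fun i =>
    integral_wasserstein_empirical_sq_le hp hS hr (h.measurable_left i) (h.law_left i)
      (h.indep.precomp (g := fun k => Sum.inl (i, k)) fun k l hkl => by simpa using hkl) hq L
  have hY : ∀ i, ∫ ω, wasserstein p (empirical fun k => Y i k ω) s ^ 2 ∂μ ≤ M := fun i =>
    integral_wasserstein_empirical_sq_le hp hS hs (h.measurable_right i) (h.law_right i)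
      (h.indep.precomp (g := fun k => Sum.inr (i, k)) fun k l hkl => by simpa using hkl) hq L
  have hXi : ∀ i, Integrable (fun ω => 2 * wasserstein p (empirical fun k => X i k ω) r ^ 2) μ :=
    fun i => integrable_comp_of_finite
      (fun x : Fin S → 𝒳 => 2 * wasserstein p (empirical x) r ^ 2)
      (measurable_pi_lambda _ (h.measurable_left i))
  have hYi : ∀ i, Integrable (fun ω => 2 * wasserstein p (empirical fun k => Y i k ω) s ^ 2) μ :=
    fun i => integrable_comp_of_finite
      (fun x : Fin S → 𝒳 => 2 * wasserstein p (empirical x) s ^ 2)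
      (measurable_pi_lambda _ (h.measurable_right i))
  calc ∫ ω, |estimator p (fun i k => X i k ω) (fun i k => Y i k ω) - wasserstein p r s| ^ 2 ∂μ
      ≤ ∫ ω, (B : ℝ)⁻¹ * ∑ i, (2 * wasserstein p (empirical fun k => X i k ω) r ^ 2
          + 2 * wasserstein p (empirical fun k => Y i k ω) s ^ 2) ∂μ :=
        integral_mono (integrable_abs_estimator_sub_sq p h)
          ((integrable_finsetSum _ fun i _ => (hXi i).add (hYi i)).const_mul _)
          fun ω => abs_estimator_sub_sq_le hp hr hs hB hS _ _
    _ = (B : ℝ)⁻¹ * ∑ i, (2 * ∫ ω, wasserstein p (empirical fun k => X i k ω) r ^ 2 ∂μ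
          + 2 * ∫ ω, wasserstein p (empirical fun k => Y i k ω) s ^ 2 ∂μ) := by
        rw [integral_const_mul]
        congr 1
        refine (integral_finsetSum _ fun i _ => (hXi i).add (hYi i)).trans ?_
        refine Finset.sum_congr rfl fun i _ => ?_
        rw [← integral_const_mul, ← integral_const_mul]
        exact integral_add (hXi i) (hYi i)
    _ ≤ (B : ℝ)⁻¹ * ∑ _i : Fin B, 4 * M := by
        refine mul_le_mul_of_nonneg_left (Finset.sum_le_sum fun i _ => ?_) (by positivity)
        linarith [hX i, hY i]
    _ = 4 * M := by
        simp [hB0]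

end MeanSquaredError

end EmpiricalOT

theorem theorem5 {𝒳 : Type*} [Fintype 𝒳] [MetricSpace 𝒳] [MeasurableSpace 𝒳]
    [MeasurableSingletonClass 𝒳] (p : ℝ) (hp : 1 ≤ p) (r s : 𝒳 → ℝ)
    (hr : r ∈ stdSimplex ℝ 𝒳) (hs : s ∈ stdSimplex ℝ 𝒳) :
    -- the bound on the mean squared error
    (∀ (B S : ℕ), 1 ≤ B → 1 ≤ S →
      ∀ {Ω : Type*} [MeasurableSpace Ω] (μ : Measure Ω) [IsProbabilityMeasure μ]
        (X Y : Fin B → Fin S → Ω → 𝒳), EmpiricalOT.IsSample μ r s X Y →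
        Integrable (fun ω => |EmpiricalOT.estimator p (fun i k => X i k ω) (fun i k => Y i k ω)
          - EmpiricalOT.wasserstein p r s| ^ 2) μ ∧
        ∀ (q L : ℕ), 2 ≤ q →
          ∫ ω, |EmpiricalOT.estimator p (fun i k => X i k ω) (fun i k => Y i k ω)
            - EmpiricalOT.wasserstein p r s| ^ 2 ∂μ
          ≤ 18 * EmpiricalOT.errorConst 𝒳 p q L ^ (2 / p) * (S : ℝ) ^ (-(1 / p))) ∧
    -- the resulting rate, as the subsample size `S` grows
    (∀ (B : ℕ → ℕ), (∀ S, 1 ≤ B S) →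
      ∀ {Ω : ℕ → Type*} [∀ S, MeasurableSpace (Ω S)] (μ : ∀ S, Measure (Ω S))
        [∀ S, IsProbabilityMeasure (μ S)] (X Y : ∀ S, Fin (B S) → Fin S → Ω S → 𝒳),
        (∀ S, EmpiricalOT.IsSample (μ S) r s (X S) (Y S)) →
        (fun S : ℕ => ∫ ω, |EmpiricalOT.estimator p (fun i k => X S i k ω) (fun i k => Y S i k ω)
            - EmpiricalOT.wasserstein p r s| ^ 2 ∂(μ S))
          =O[atTop] fun S : ℕ => (S : ℝ) ^ (-(1 / p))) := by
  refine ⟨fun B S hB hS Ω _ μ _ X Y h =>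
    ⟨EmpiricalOT.integrable_abs_estimator_sub_sq p h, fun q L hq => ?_⟩, ?_⟩
  · refine (EmpiricalOT.integral_abs_estimator_sub_sq_le hp hr hs hB hS h hq L).trans ?_
    rw [mul_assoc]
    have hE := EmpiricalOT.errorConst_nonneg (𝒳 := 𝒳) p q L
    exact mul_le_mul_of_nonneg_right (by norm_num) (by positivity)
  · intro B hB Ω _ μ _ X Y h
    refine IsBigO.of_bound (4 * EmpiricalOT.errorConst 𝒳 p 2 0 ^ (2 / p)) ?_
    filter_upwards [eventually_ge_atTop 1] with S hS
    rw [Real.norm_of_nonneg (integral_nonneg fun ω => sq_nonneg _),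
      Real.norm_of_nonneg (Real.rpow_nonneg (Nat.cast_nonneg S) _), mul_assoc]
    exact EmpiricalOT.integral_abs_estimator_sub_sq_le hp hr hs (hB S) hS (h S) le_rfl 0
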